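/- Let $X,Y$ be real locally convex Hausdorff topological vector spaces with topological duals $X^*,Y^*$, and let $M:X\to Y$ be a continuous linear mapping. Let $D\subset X$ be a generalized polyhedral convex set, i.e. $D=\{x\in L \mid \langle x_i^*,x\rangle\le\alpha_i,\ i=1,\dots,p\}$ for some closed affine subspace $L\subset X$, $x_i^*\in X^*$ and $\alpha_i\in\mathbb R$. Let $K\subset Y$ be a polyhedral convex cone, i.e. $K=\{y\in Y\mid \langle y_j^*,y\rangle\le 0,\ j=1,\dots,q\}$ for some $y_j^*\in Y^*\setminus\{0\}$; put $\ell(K)=K\cap(-K)$. Here $p$ and $q$ are nonnegative integers (possibly $0$). Let $E$ be the efficient solution set of the generalized linear vector optimization problem (VLP) $\ \min_K\{Mx\mid x\in D\}$, that is, the set of all $u\in D$ for which there is no $x\in D$ with $Mu-Mx\in K\setminus\ell(K)$. Then $E$ is connected by line segments: for any $u,v\in E$ there exist finitely many elements $u_1,\dots,u_r$ of $E$, with $u_1=u$ and $u_r=v$, such that $[u_i,u_{i+1}]\subset E$ for all $i=1,\dots,r-1$, where $[a,b]=\{(1-t)a+tb\mid t\in[0,1]\}$. -/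

import Mathlib

open scoped Pointwise

/-- A generalized polyhedral convex set: the intersection of a closed affine subspace with finitely
many closed half-spaces given by continuous linear functionals. -/
def IsGenPolyhedralConvex {X : Type*} [AddCommGroup X] [Module ℝ X] [TopologicalSpace X]
    (D : Set X) : Prop :=
  ∃ (L : AffineSubspace ℝ X) (p : ℕ) (f : Fin p → StrongDual ℝ X) (α : Fin p → ℝ),
    IsClosed (L : Set X) ∧ D = {x | x ∈ L ∧ ∀ i, f i x ≤ α i}

/-- A polyhedral convex cone: the solution set of finitely many homogeneous inequalities
`⟨g j, y⟩ ≤ 0` with nonzero continuous linear functionals (none of them gives the whole space). -/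
def IsPolyhedralConvexCone {Y : Type*} [AddCommGroup Y] [Module ℝ Y] [TopologicalSpace Y]
    (K : Set Y) : Prop :=
  ∃ (q : ℕ) (g : Fin q → StrongDual ℝ Y),
    (∀ j, g j ≠ 0) ∧ K = {y | ∀ j, g j y ≤ 0}

/-- The lineality part `ℓ(K) = K ∩ (-K)`. -/
def linealityPart {Y : Type*} [AddCommGroup Y] (K : Set Y) : Set Y := K ∩ (-K)

/-- The efficient solutions of `min_K {M x | x ∈ D}`: the `u ∈ D` for which no `x ∈ D` satisfies
`M u - M x ∈ K \ ℓ(K)`. -/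
def efficientSet {X Y : Type*} [AddCommGroup X] [Module ℝ X] [TopologicalSpace X]
    [AddCommGroup Y] [Module ℝ Y] [TopologicalSpace Y]
    (M : X →L[ℝ] Y) (D : Set X) (K : Set Y) : Set X :=
  {u | u ∈ D ∧ ¬ ∃ x ∈ D, M u - M x ∈ K \ linealityPart K}

/-- `E` is connected by line segments: any two points of `E` are joined by a finite chain of points
of `E` whose consecutive closed segments lie in `E`. The chain has `r + 1` points. -/
def IsConnectedByLineSegments {X : Type*} [AddCommGroup X] [Module ℝ X] (E : Set X) : Prop :=
  ∀ u ∈ E, ∀ v ∈ E, ∃ (r : ℕ) (w : Fin (r + 1) → X),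
    w 0 = u ∧ w (Fin.last r) = v ∧ (∀ i, w i ∈ E) ∧
      ∀ i : Fin r, segment ℝ (w i.castSucc) (w i.succ) ⊆ E

/-!
In terms of the linear functionals `c j = g j ∘ M`, where `K = {y | ∀ j, g j y ≤ 0}`, an efficient
point is a Pareto-maximal point of the polyhedron `D` for the objectives `c j`. By Farkas' lemma
(`exists_nonneg_combination_of_forall_nonpos`) these are exactly the points that maximize some
combination `∑ j, w j • c j` with all `w j > 0` over `D`
(`exists_weights_of_mem_paretoMaximizers`).

Given two efficient points with weights `w₀` and `w₁`, move the weights along the segment from `w₀`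
to `w₁`. At every parameter `t ∈ [0, 1]` the scalarized objective is bounded above on `D`, hence
attains its maximum (`nonempty_maximizers`), and its maximizers form a convex set of efficient
points. This set is a union of faces of `D`. There are finitely many faces, and each is optimal for
a closed set of parameters, so the optimal sets at nearby parameters intersect
(`eventually_nonempty_maximizers_inter`). Within one optimal set any two points are joined by a
segment, so connectedness of `[0, 1]` produces a finite chain of segments between the two points.

The argument is algebraic: Farkas' lemma is proved for functionals on an arbitrary real vector
space by elimination, which replaces closedness and separation arguments in infinite dimension.
-/

/-! ### Farkas' lemma -/

section LinearInequalities

variable {V ι : Type*} [AddCommGroup V] [Module ℝ V]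

/-- **Farkas' lemma** for finitely many linear functionals on an arbitrary real vector space. By
induction on the number of functionals: if the last functional `a n` is needed, some `x` satisfies
all other inequalities and violates the conclusion, and projecting along `x` onto `ker (a n)`
eliminates `a n`. -/
theorem exists_nonneg_combination_of_forall_nonpos (s : Finset ι) (a : ι → Module.Dual ℝ V)
    (b : Module.Dual ℝ V) (h : ∀ d, (∀ k ∈ s, a k d ≤ 0) → b d ≤ 0) :
    ∃ μ : ι → ℝ, (∀ k, 0 ≤ μ k) ∧ b = ∑ k ∈ s, μ k • a k := by
  classical
  induction s using Finset.induction_on generalizing a b with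
  | empty =>
    refine ⟨0, fun _ => le_rfl, ?_⟩
    ext d
    have h₁ := h d (by simp)
    have h₂ := h (-d) (by simp)
    rw [map_neg] at h₂
    simp only [Finset.sum_empty, LinearMap.zero_apply]
    linarith
  | insert n s hn ih =>
    by_cases hs : ∀ d, (∀ k ∈ s, a k d ≤ 0) → b d ≤ 0
    · obtain ⟨μ, hμ, rfl⟩ := ih a b hs
      refine ⟨fun k => if k = n then 0 else μ k, fun k => ?_, ?_⟩
      · dsimp only
        split_ifs
        exacts [le_rfl, hμ k]
      · simp only [Finset.sum_insert hn, if_true, zero_smul, zero_add]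
        refine Finset.sum_congr rfl fun k hk => ?_
        rw [if_neg (ne_of_mem_of_not_mem hk hn)]
    · push Not at hs
      obtain ⟨y, hy, hby⟩ := hs
      have hny : 0 < a n y := by
        by_contra! hle
        exact hby.not_ge (h y fun k hk => by
          rcases Finset.mem_insert.1 hk with rfl | hk
          exacts [hle, hy k hk])
      -- Normalise the violating vector so that `a n x = 1`, and project along it onto `ker (a n)`.
      set x := (a n y)⁻¹ • y with hx
      have hnx : a n x = 1 := by simp [hx, hny.ne']
      have hax : ∀ k ∈ s, a k x ≤ 0 := fun k hk => by
        rw [hx, map_smul, smul_eq_mul]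
        exact mul_nonpos_of_nonneg_of_nonpos (inv_nonneg.2 hny.le) (hy k hk)
      have hbx : 0 ≤ b x := by
        rw [hx, map_smul, smul_eq_mul]
        exact mul_nonneg (inv_nonneg.2 hny.le) hby.le
      obtain ⟨μ, hμ, hb⟩ := ih (fun k => a k - a k x • a n) (b - b x • a n) fun d hd => by
        have := h (d - a n d • x) fun k hk => by
          rcases Finset.mem_insert.1 hk with rfl | hk
          · simp [hnx]
          · have := hd k hk
            simp only [LinearMap.sub_apply, LinearMap.smul_apply, smul_eq_mul] at this
            simp only [map_sub, map_smul, smul_eq_mul]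
            linarith
        simp only [map_sub, map_smul, smul_eq_mul] at this
        simp only [LinearMap.sub_apply, LinearMap.smul_apply, smul_eq_mul]
        linarith
      refine ⟨fun k => if k = n then b x - ∑ k ∈ s, μ k * a k x else μ k, fun k => ?_, ?_⟩
      · dsimp only
        split_ifs
        · have : ∑ k ∈ s, μ k * a k x ≤ 0 :=
            Finset.sum_nonpos fun k hk => mul_nonpos_of_nonneg_of_nonpos (hμ k) (hax k hk)
          linarith
        · exact hμ k
      · have hsum : ∑ k ∈ s, (if k = n then b x - ∑ k ∈ s, μ k * a k x else μ k) • a k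
            = ∑ k ∈ s, μ k • a k :=
          Finset.sum_congr rfl fun k hk => by rw [if_neg (ne_of_mem_of_not_mem hk hn)]
        simp only [Finset.sum_insert hn, if_true, hsum]
        ext d
        have := congrArg (fun φ : Module.Dual ℝ V => φ d) hb
        simp only [LinearMap.sub_apply, LinearMap.smul_apply, smul_eq_mul, LinearMap.sum_apply,
          mul_sub, Finset.sum_sub_distrib, ← mul_assoc, ← Finset.sum_mul] at this
        simp only [LinearMap.add_apply, LinearMap.smul_apply, smul_eq_mul, LinearMap.sum_apply]
        linarith

end LinearInequalities

/-! ### Linear programs over polyhedra -/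

section LinearPrograms

variable {X ι : Type*} [AddCommGroup X] [Module ℝ X]

/-- The subset of an affine subspace `L` cut out by the inequalities `f i x ≤ α i`, with `f i`
arbitrary linear functionals on a real vector space without topology. -/
def polyhedron (L : AffineSubspace ℝ X) (f : ι → Module.Dual ℝ X) (α : ι → ℝ) : Set X :=
  {x | x ∈ L ∧ ∀ i, f i x ≤ α i}

/-- The optimal solutions of the problem of maximizing the linear functional `φ` over `D`. -/
def maximizers (D : Set X) (φ : Module.Dual ℝ X) : Set X :=
  {x | x ∈ D ∧ ∀ y ∈ D, φ y ≤ φ x}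

theorem convex_polyhedron (L : AffineSubspace ℝ X) (f : ι → Module.Dual ℝ X) (α : ι → ℝ) :
    Convex ℝ (polyhedron L f α) := by
  intro x hx y hy a b ha hb hab
  refine ⟨L.convex hx.1 hy.1 ha hb hab, fun i => ?_⟩
  simp only [map_add, map_smul, smul_eq_mul]
  calc a * f i x + b * f i y ≤ a * α i + b * α i := by
        gcongr
        exacts [hx.2 i, hy.2 i]
    _ = α i := by rw [← add_mul, hab, one_mul]

theorem convex_maximizers {D : Set X} (hD : Convex ℝ D) (φ : Module.Dual ℝ X) :
    Convex ℝ (maximizers D φ) := by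
  intro x hx y hy a b ha hb hab
  refine ⟨hD hx.1 hy.1 ha hb hab, fun z hz => ?_⟩
  simp only [map_add, map_smul, smul_eq_mul]
  calc φ z = a * φ z + b * φ z := by rw [← add_mul, hab, one_mul]
    _ ≤ a * φ x + b * φ y := by
        gcongr
        exacts [hx.2 z hz, hy.2 z hz]

variable [Fintype ι] {L : AffineSubspace ℝ X} {f : ι → Module.Dual ℝ X} {α : ι → ℝ}

/-- A direction that does not increase the active constraints at `x` is feasible at `x`: the
inactive ones, being finitely many, leave room for a common positive step. -/
theorem exists_pos_add_smul_mem_polyhedron {x d : X} (hx : x ∈ polyhedron L f α)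
    (hd : d ∈ L.direction) (h : ∀ i, f i x = α i → f i d ≤ 0) :
    ∃ ε : ℝ, 0 < ε ∧ x + ε • d ∈ polyhedron L f α := by
  have hev : ∀ i, ∀ᶠ ε : ℝ in nhdsWithin 0 (Set.Ioi 0), f i (x + ε • d) ≤ α i := fun i => by
    simp only [map_add, map_smul, smul_eq_mul]
    rcases (hx.2 i).eq_or_lt with hi | hi
    · filter_upwards [self_mem_nhdsWithin] with ε hε
      have := mul_nonpos_of_nonneg_of_nonpos (le_of_lt hε) (h i hi)
      linarith
    · have hc : Continuous fun ε : ℝ => f i x + ε * f i d := by fun_prop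
      have : ∀ᶠ ε : ℝ in nhds 0, f i x + ε * f i d < α i :=
        hc.continuousAt.eventually_lt continuousAt_const (by simpa using hi)
      exact (this.filter_mono nhdsWithin_le_nhds).mono fun ε hε => hε.le
  obtain ⟨ε, hε, hpos⟩ := ((Filter.eventually_all.2 hev).and self_mem_nhdsWithin).exists
  refine ⟨ε, hpos, ?_, hε⟩
  rw [add_comm]
  exact AffineSubspace.vadd_mem_of_mem_direction (L.direction.smul_mem ε hd) hx.1

/-- Maximizers fill faces: a feasible point satisfying with equality all constraints active at a
maximizer is a maximizer, since otherwise stepping from the maximizer away from that point would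
improve the objective. -/
theorem mem_maximizers_of_active {φ : Module.Dual ℝ X} {x y : X}
    (hx : x ∈ maximizers (polyhedron L f α) φ) (hy : y ∈ polyhedron L f α)
    (h : ∀ i, f i x = α i → f i y = α i) : y ∈ maximizers (polyhedron L f α) φ := by
  obtain ⟨ε, hε, hmem⟩ := exists_pos_add_smul_mem_polyhedron hx.1 (d := x - y)
    (AffineSubspace.vsub_mem_direction hx.1.1 hy.1) fun i hi => by rw [map_sub, hi, h i hi, sub_self]
  have := hx.2 _ hmem
  simp only [map_add, map_smul, smul_eq_mul, map_sub] at this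
  have hle : φ x ≤ φ y := by
    by_contra! hlt
    have := mul_pos hε (sub_pos.2 hlt)
    linarith
  exact ⟨hy, fun z hz => (hx.2 z hz).trans hle⟩

/-- A linear functional bounded above on a nonempty polyhedron attains its supremum `γ`. If the
system `f i v ≤ α i - f i x₀`, `γ - φ x₀ ≤ φ v` in the displacement `v` from a feasible `x₀` had no
solution, Farkas' lemma applied to its homogenization on `L.direction × ℝ` would bound `φ` away from `γ`. -/
theorem nonempty_maximizers {φ : Module.Dual ℝ X} (hne : (polyhedron L f α).Nonempty)
    (hbdd : BddAbove (φ '' polyhedron L f α)) :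
    (maximizers (polyhedron L f α) φ).Nonempty := by
  classical
  obtain ⟨x₀, hx₀⟩ := hne
  set γ := sSup (φ '' polyhedron L f α) with hγ
  have hle : ∀ x ∈ polyhedron L f α, φ x ≤ γ := fun x hx =>
    le_csSup hbdd (Set.mem_image_of_mem _ hx)
  by_contra hempty
  have hlt : ∀ x ∈ polyhedron L f α, φ x < γ := fun x hx =>
    (hle x hx).lt_of_ne fun heq => hempty ⟨x, hx, fun y hy => heq ▸ hle y hy⟩
  let ι' := L.direction.subtype ∘ₗ LinearMap.fst ℝ L.direction ℝ
  let σ : Module.Dual ℝ (L.direction × ℝ) := LinearMap.snd ℝ L.direction ℝ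
  let a : Option ι → Module.Dual ℝ (L.direction × ℝ) := fun o =>
    o.elim ((γ - φ x₀) • σ - φ ∘ₗ ι') fun i => f i ∘ₗ ι' - (α i - f i x₀) • σ
  obtain ⟨μ, hμ, hσ⟩ := exists_nonneg_combination_of_forall_nonpos Finset.univ a σ <| by
    rintro ⟨v, s⟩ hd
    by_contra! hs
    change 0 < s at hs
    have hf : ∀ i, f i v - (α i - f i x₀) * s ≤ 0 := fun i => hd (some i) (Finset.mem_univ _)
    have hφ : (γ - φ x₀) * s - φ v ≤ 0 := hd none (Finset.mem_univ _)
    have hmem : s⁻¹ • (v : X) + x₀ ∈ polyhedron L f α := by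
      refine ⟨AffineSubspace.vadd_mem_of_mem_direction
        (L.direction.smul_mem _ v.2) hx₀.1, fun i => ?_⟩
      rw [map_add, map_smul, smul_eq_mul, ← le_sub_iff_add_le, inv_mul_le_iff₀ hs]
      linarith [hf i]
    have := hlt _ hmem
    rw [map_add, map_smul, smul_eq_mul, ← lt_sub_iff_add_lt, inv_mul_lt_iff₀ hs] at this
    linarith
  -- The certificate, evaluated at a point of the polyhedron, separates `φ` from `γ`.
  have hsep : ∀ x ∈ polyhedron L f α, 1 ≤ μ none * (γ - φ x) := fun x hx => by
    have h1 := congrArg (fun ψ : Module.Dual ℝ (L.direction × ℝ) =>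
      ψ (⟨x - x₀, AffineSubspace.vsub_mem_direction hx.1 hx₀.1⟩, 1)) hσ
    simp only [Fintype.sum_option, LinearMap.add_apply, LinearMap.sum_apply,
      LinearMap.smul_apply, smul_eq_mul] at h1
    have h2 : ∀ i, μ (some i) * a (some i)
        (⟨x - x₀, AffineSubspace.vsub_mem_direction hx.1 hx₀.1⟩, 1) ≤ 0 := fun i => by
      refine mul_nonpos_of_nonneg_of_nonpos (hμ _) ?_
      change f i (x - x₀) - (α i - f i x₀) * 1 ≤ 0
      rw [map_sub]
      linarith [hx.2 i]
    have h3 := Finset.sum_nonpos fun i (_ : i ∈ Finset.univ) => h2 i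
    change (1 : ℝ) = μ none * ((γ - φ x₀) * 1 - φ (x - x₀)) + _ at h1
    rw [map_sub] at h1
    have h4 : (γ - φ x₀) * 1 - (φ x - φ x₀) = γ - φ x := by ring
    rw [h4] at h1
    linarith
  have hpos : 0 < μ none + 1 := by linarith [hμ none]
  obtain ⟨_, ⟨x, hx, rfl⟩, hx'⟩ := exists_lt_of_lt_csSup (Set.Nonempty.image φ ⟨x₀, hx₀⟩)
    (show γ - (μ none + 1)⁻¹ < γ by linarith [inv_pos.2 hpos])
  have h1 := hsep x hx
  have h2 : (μ none + 1) * (γ - φ x) < 1 := by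
    rw [← lt_inv_mul_iff₀ hpos]
    linarith
  linarith [hle x hx]

end LinearPrograms

/-! ### Scalarization of Pareto-maximal points -/

section Scalarization

variable {X ι κ : Type*} [AddCommGroup X] [Module ℝ X] [Fintype κ]

/-- The points of `D` that are Pareto-maximal for the linear objectives `c j`. -/
def paretoMaximizers (D : Set X) (c : κ → Module.Dual ℝ X) : Set X :=
  {u | u ∈ D ∧ ∀ x ∈ D, (∀ j, c j u ≤ c j x) → ∀ j, c j x ≤ c j u}

theorem maximizers_subset_paretoMaximizers (D : Set X) (c : κ → Module.Dual ℝ X) {w : κ → ℝ}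
    (hw : ∀ j, 0 < w j) : maximizers D (∑ j, w j • c j) ⊆ paretoMaximizers D c := by
  refine fun u hu => ⟨hu.1, fun x hx hle j => ?_⟩
  by_contra! hlt
  refine (hu.2 x hx).not_gt ?_
  simp only [LinearMap.sum_apply, LinearMap.smul_apply, smul_eq_mul]
  exact Finset.sum_lt_sum (fun i _ => mul_le_mul_of_nonneg_left (hle i) (hw i).le)
    ⟨j, Finset.mem_univ j, mul_lt_mul_of_pos_left hlt (hw j)⟩

/-- Linear scalarization is exact on polyhedra. At a Pareto-maximal `u` no feasible direction
improves `∑ j, c j` without lowering some `c j`; Farkas' lemma turns this into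
`∑ j, c j = ∑ i, μ i • f i - ∑ j, ν j • c j` with `i` ranging over the constraints active at `u`,
and the weights are `1 + ν j`. -/
theorem exists_weights_of_mem_paretoMaximizers [Fintype ι] {L : AffineSubspace ℝ X}
    {f : ι → Module.Dual ℝ X} {α : ι → ℝ} {c : κ → Module.Dual ℝ X} {u : X}
    (hu : u ∈ paretoMaximizers (polyhedron L f α) c) :
    ∃ w : κ → ℝ, (∀ j, 0 < w j) ∧ u ∈ maximizers (polyhedron L f α) (∑ j, w j • c j) := by
  classical
  let s := Finset.univ.filter fun i => f i u = α i
  let a : ι ⊕ κ → Module.Dual ℝ L.direction :=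
    Sum.elim (fun i => f i ∘ₗ L.direction.subtype) fun j => -(c j ∘ₗ L.direction.subtype)
  obtain ⟨μ, hμ, hsum⟩ := exists_nonneg_combination_of_forall_nonpos
    (s.disjSum Finset.univ) a (∑ j, c j ∘ₗ L.direction.subtype) <| by
    intro d hd
    have hf : ∀ i, f i u = α i → f i d ≤ 0 := fun i hi =>
      hd (Sum.inl i) (Finset.inl_mem_disjSum.2 (Finset.mem_filter.2 ⟨Finset.mem_univ _, hi⟩))
    have hc : ∀ j, 0 ≤ c j d := fun j => by
      have : -c j d ≤ 0 := hd (Sum.inr j) (Finset.inr_mem_disjSum.2 (Finset.mem_univ _))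
      linarith
    obtain ⟨ε, hε, hmem⟩ := exists_pos_add_smul_mem_polyhedron hu.1 d.2 hf
    have hle := hu.2 _ hmem fun j => by
      rw [map_add, map_smul, smul_eq_mul]
      linarith [mul_nonneg hε.le (hc j)]
    rw [LinearMap.sum_apply]
    refine Finset.sum_nonpos fun j _ => ?_
    have hj := hle j
    rw [map_add, map_smul, smul_eq_mul, add_le_iff_nonpos_right] at hj
    exact nonpos_of_mul_nonpos_right hj hε
  refine ⟨fun j => 1 + μ (Sum.inr j), fun j => by linarith [hμ (Sum.inr j)], hu.1,
    fun x hx => ?_⟩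
  have h1 := congrArg (fun ψ : Module.Dual ℝ L.direction =>
    ψ ⟨x - u, AffineSubspace.vsub_mem_direction hx.1 hu.1.1⟩) hsum
  simp only [Finset.sum_disjSum, LinearMap.add_apply, LinearMap.sum_apply, LinearMap.smul_apply,
    smul_eq_mul, a, Sum.elim_inl, Sum.elim_inr, LinearMap.neg_apply, LinearMap.comp_apply,
    Submodule.subtype_apply, mul_neg, Finset.sum_neg_distrib] at h1
  have h2 : ∑ i ∈ s, μ (Sum.inl i) * f i (x - u) ≤ 0 := by
    refine Finset.sum_nonpos fun i hi => mul_nonpos_of_nonneg_of_nonpos (hμ _) ?_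
    rw [map_sub, (Finset.mem_filter.1 hi).2]
    linarith [hx.2 i]
  have h3 : (∑ j, (1 + μ (Sum.inr j)) • c j) (x - u) ≤ 0 := by
    simp only [LinearMap.sum_apply, LinearMap.smul_apply, smul_eq_mul, add_mul, one_mul,
      Finset.sum_add_distrib]
    linarith
  rw [map_sub] at h3
  linarith

end Scalarization

/-! ### Chains of segments -/

section Chains

variable {X : Type*} [AddCommGroup X] [Module ℝ X]

theorem isConnectedByLineSegments_of_reflTransGen {E : Set X}
    (h : ∀ u ∈ E, ∀ v ∈ E, Relation.ReflTransGen (fun x y => segment ℝ x y ⊆ E) u v) :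
    IsConnectedByLineSegments E := by
  intro u hu v hv
  have huv := h u hu v hv
  clear h
  induction huv using Relation.ReflTransGen.head_induction_on with
  | refl => exact ⟨0, fun _ => v, rfl, rfl, fun _ => hv, fun i => i.elim0⟩
  | @head a b hab _ ih =>
    obtain ⟨r, w, h0, hlast, hmem, hseg⟩ := ih (hab (right_mem_segment ℝ a b))
    refine ⟨r + 1, Fin.cons a w, rfl, ?_, fun i => ?_, fun i => ?_⟩
    · rw [← Fin.succ_last, Fin.cons_succ, hlast]
    · induction i using Fin.cases with
      | zero => exact hu
      | succ i => simpa using hmem i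
    · induction i using Fin.cases with
      | zero => simpa [h0] using hab
      | succ i => simpa using hseg i

end Chains

/-! ### Connectedness of the Pareto-maximal set -/

section ParetoConnected

variable {X ι κ : Type*} [AddCommGroup X] [Module ℝ X] [Fintype ι] [Fintype κ]
  {L : AffineSubspace ℝ X} {f : ι → Module.Dual ℝ X} {α : ι → ℝ}

/-- Along a segment of objectives, the optimal sets of nearby parameters meet. The parameters
for which a given face consists of maximizers form a closed set, and there are finitely many
faces, so near `t` only those faces occur that are also optimal at `t`. -/
theorem eventually_nonempty_maximizers_inter (φ ψ : Module.Dual ℝ X) {T : Set ℝ}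
    (hT : ∀ t ∈ T, (maximizers (polyhedron L f α) (AffineMap.lineMap φ ψ t)).Nonempty) (t : ℝ) :
    ∀ᶠ s in nhdsWithin t T, (maximizers (polyhedron L f α) (AffineMap.lineMap φ ψ t) ∩
      maximizers (polyhedron L f α) (AffineMap.lineMap φ ψ s)).Nonempty := by
  classical
  let face : Set ι → Set X := fun I => {x | x ∈ polyhedron L f α ∧ ∀ i ∈ I, f i x = α i}
  let opt : Set ι → Set ℝ := fun I =>
    {s | ∀ x ∈ face I, ∀ y ∈ polyhedron L f α,
      AffineMap.lineMap φ ψ s y ≤ AffineMap.lineMap φ ψ s x}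
  have heval : ∀ x, Continuous fun s : ℝ => (AffineMap.lineMap φ ψ s : Module.Dual ℝ X) x :=
    fun x => by
      simp only [AffineMap.lineMap_apply_module, LinearMap.add_apply, LinearMap.smul_apply,
        smul_eq_mul]
      fun_prop
  have hclosed : ∀ I, IsClosed (opt I) := fun I => by
    simp only [opt, Set.ofPred_forall]
    exact isClosed_iInter fun x => isClosed_iInter fun _ => isClosed_iInter fun y =>
      isClosed_iInter fun _ => isClosed_le (heval y) (heval x)
  have hev : ∀ᶠ s in nhds t, ∀ I, s ∈ opt I → t ∈ opt I := by
    refine Filter.eventually_all.2 fun I => ?_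
    by_cases ht : t ∈ opt I
    · exact Filter.Eventually.of_forall fun _ _ => ht
    · filter_upwards [(hclosed I).isOpen_compl.mem_nhds ht] with s hs hs'
      exact absurd hs' hs
  filter_upwards [hev.filter_mono nhdsWithin_le_nhds, self_mem_nhdsWithin] with s hs hsT
  obtain ⟨x, hx⟩ := hT s hsT
  refine ⟨x, ⟨hx.1, hs {i | f i x = α i} (fun y hy => ?_) x ⟨hx.1, fun _ hi => hi⟩⟩, hx⟩
  exact (mem_maximizers_of_active hx hy.1 hy.2).2

theorem isConnectedByLineSegments_paretoMaximizers (c : κ → Module.Dual ℝ X) :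
    IsConnectedByLineSegments (paretoMaximizers (polyhedron L f α) c) := by
  refine isConnectedByLineSegments_of_reflTransGen fun u hu v hv => ?_
  obtain ⟨w₀, hw₀, hu'⟩ := exists_weights_of_mem_paretoMaximizers hu
  obtain ⟨w₁, hw₁, hv'⟩ := exists_weights_of_mem_paretoMaximizers hv
  set D := polyhedron L f α
  set φ := ∑ j, w₀ j • c j
  set ψ := ∑ j, w₁ j • c j
  let A : ℝ → Set X := fun t => maximizers D (AffineMap.lineMap φ ψ t)
  have hline : ∀ (t : ℝ) (x : X), (AffineMap.lineMap φ ψ t : Module.Dual ℝ X) x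
      = (1 - t) * φ x + t * ψ x := fun t x => by
    simp [AffineMap.lineMap_apply_module]
  have hA : ∀ t ∈ Set.Icc (0 : ℝ) 1, (A t).Nonempty := fun t ht => by
    refine nonempty_maximizers ⟨u, hu.1⟩ ⟨(1 - t) * φ u + t * ψ v, ?_⟩
    rintro _ ⟨x, hx, rfl⟩
    rw [hline]
    exact add_le_add (mul_le_mul_of_nonneg_left (hu'.2 x hx) (sub_nonneg.2 ht.2))
      (mul_le_mul_of_nonneg_left (hv'.2 x hx) ht.1)
  have hAE : ∀ t ∈ Set.Icc (0 : ℝ) 1, A t ⊆ paretoMaximizers D c := fun t ht => by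
    have hw : (AffineMap.lineMap φ ψ t : Module.Dual ℝ X)
        = ∑ j, ((1 - t) * w₀ j + t * w₁ j) • c j := by
      simp only [AffineMap.lineMap_apply_module, φ, ψ, Finset.smul_sum, smul_smul, add_smul,
        Finset.sum_add_distrib]
    simp only [A, hw]
    refine maximizers_subset_paretoMaximizers D c fun j => ?_
    exact (convex_Ioi (0 : ℝ)) (hw₀ j) (hw₁ j) (sub_nonneg.2 ht.2) ht.1 (sub_add_cancel 1 t)
  have hseg : ∀ t ∈ Set.Icc (0 : ℝ) 1, ∀ x ∈ A t, ∀ y ∈ A t,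
      segment ℝ x y ⊆ paretoMaximizers D c := fun t ht x hx y hy =>
    ((convex_maximizers (convex_polyhedron L f α) _).segment_subset hx hy).trans (hAE t ht)
  have key := isPreconnected_Icc.induction₂ (s := Set.Icc (0 : ℝ) 1)
    (fun s t => ∀ x ∈ A s, ∀ y ∈ A t,
      Relation.ReflTransGen (fun x y => segment ℝ x y ⊆ paretoMaximizers D c) x y)
    (fun t ht => by
      filter_upwards [eventually_nonempty_maximizers_inter φ ψ hA t, self_mem_nhdsWithin]
        with s ⟨z, hzt, hzs⟩ hs
      intro x hx y hy
      refine Relation.ReflTransGen.trans (b := z) (.single ?_) (.single ?_)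
      exacts [hseg t ht x hx z hzt, hseg s hs z hzs y hy])
    (fun r s t _ hs _ hrs hst x hx y hy => by
      obtain ⟨z, hz⟩ := hA s hs
      exact (hrs x hx z hz).trans (hst z hz y hy))
    (fun s t _ _ hst x hx y hy => by
      have hsymm : Std.Symm fun x y : X => segment ℝ x y ⊆ paretoMaximizers D c :=
        ⟨fun x y hxy => by rwa [segment_symm]⟩
      exact symm (hst y hy x hx))
    (Set.left_mem_Icc.2 zero_le_one) (Set.right_mem_Icc.2 zero_le_one)
  refine key u ?_ v ?_
  · simpa [A] using hu'
  · simpa [A] using hv'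

end ParetoConnected

/-! ### Efficient solutions -/

theorem efficientSet_eq_paretoMaximizers {X Y κ : Type*} [AddCommGroup X] [Module ℝ X]
    [TopologicalSpace X] [AddCommGroup Y] [Module ℝ Y] [TopologicalSpace Y] (M : X →L[ℝ] Y)
    (D : Set X) (g : κ → StrongDual ℝ Y) :
    efficientSet M D {y | ∀ j, g j y ≤ 0} =
      paretoMaximizers D fun j => ((g j).comp M : X →L[ℝ] ℝ).toLinearMap := by
  ext u
  simp only [efficientSet, paretoMaximizers, linealityPart, Set.mem_ofPred_eq, Set.mem_sdiff,
    Set.mem_inter_iff, Set.mem_neg, map_neg, map_sub, not_exists, not_and, Classical.not_imp,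
    not_not, ContinuousLinearMap.coe_coe, ContinuousLinearMap.comp_apply, neg_nonpos, sub_nonneg,
    sub_nonpos]
  exact and_congr_right fun _ => forall₂_congr fun x _ =>
    ⟨fun h hx => (h hx).2, fun h hx => ⟨hx, h hx⟩⟩

theorem theorem3p3 {X Y : Type*}
    [AddCommGroup X] [Module ℝ X] [TopologicalSpace X] [IsTopologicalAddGroup X]
    [ContinuousSMul ℝ X] [LocallyConvexSpace ℝ X] [T2Space X]
    [AddCommGroup Y] [Module ℝ Y] [TopologicalSpace Y] [IsTopologicalAddGroup Y]
    [ContinuousSMul ℝ Y] [LocallyConvexSpace ℝ Y] [T2Space Y]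
    (M : X →L[ℝ] Y) (D : Set X) (hD : IsGenPolyhedralConvex D)
    (K : Set Y) (hK : IsPolyhedralConvexCone K) :
    IsConnectedByLineSegments (efficientSet M D K) := by
  obtain ⟨L, p, f, α, -, rfl⟩ := hD
  obtain ⟨q, g, -, rfl⟩ := hK
  rw [efficientSet_eq_paretoMaximizers]
  exact isConnectedByLineSegments_paretoMaximizers (L := L) (f := fun i => (f i).toLinearMap)
    (α := α) _
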